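/- Let $n\ge 3$, let $D_n=\{t^a x^b : a\in\mathbb{Z}_2,\ b\in\mathbb{Z}_n\}$ be the dihedral group of order $2n$ ($x^n=t^2=1$, $xt=tx^{-1}$), let $B=\mathrm{Perm}(D_n)$ be the group of permutations of its underlying set, and let $\lambda(D_n)\le B$ be the left regular representation. Let $R(D_n,[D_n])$ be the set of all subgroups $N\le B$ that are regular (transitive and fixed-point free), isomorphic to $D_n$, and normalized by $\lambda(D_n)$. Put $X_0=\{1,x,\dots,x^{n-1}\}$ and $Y_0=\{t,tx,\dots,tx^{n-1}\}$, let $W(X_0,Y_0)\cong S_n\wr S_2$ be the subgroup of all $w\in B$ that either fix each of $X_0$ and $Y_0$ setwise or interchange them, and let $$R(D_n,[D_n];W(X_0,Y_0))=\{N\in R(D_n,[D_n]) : \mathrm{Norm}_B(N)\le W(X_0,Y_0)\}.$$ Let $\Upsilon_n=\{u\in U_n : u^2=1\}$, where $U_n$ is the group of units modulo $n$, and $\mu_n=|\{v\in\Upsilon_n : \gcd(v+1,n)=2\}|$. (a) If $n$ is odd, then every $N\in R(D_n,[D_n])$ satisfies $\mathrm{Norm}_B(N)\le W(X_0,Y_0)$,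 and $$|R(D_n,[D_n])|=|R(D_n,[D_n];W(X_0,Y_0))|=|\Upsilon_n|.$$ (b) If $n$ is even, then $$|R(D_n,[D_n];W(X_0,Y_0))|=\mu_n|\Upsilon_n|,$$ and $\mu_n=2$ if $8\mid n$, while $\mu_n=1$ otherwise. -/

import Mathlib

/-- The left regular representation `λ(G) ≤ Perm(G)`. -/
def leftRegular (G : Type*) [Group G] : Subgroup (Equiv.Perm G) :=
  (MulAction.toPermHom G G).range

/-- A subgroup `N ≤ Perm(Z)` is regular: it acts transitively and fixed-point freely on `Z`. -/
def IsRegularSubgroup {Z : Type*} (N : Subgroup (Equiv.Perm Z)) : Prop :=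
  (∀ a b : Z, ∃ σ ∈ N, σ a = b) ∧ ∀ σ ∈ N, (∃ z : Z, σ z = z) → σ = 1

/-- `R(G)`: the regular subgroups of `Perm(G)` whose normalizer contains `λ(G)`. -/
def regularNormalized (G : Type*) [Group G] : Set (Subgroup (Equiv.Perm G)) :=
  {N | IsRegularSubgroup N ∧ leftRegular G ≤ Subgroup.normalizer N}

/-- `R(G,[M])`: the members of `R(G)` that are isomorphic to `M`. -/
def regularNormalizedOfType (G M : Type*) [Group G] [Group M] :
    Set (Subgroup (Equiv.Perm G)) :=
  {N | N ∈ regularNormalized G ∧ Nonempty (N ≃* M)}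

/-- `R(G,[M];W)`: the members of `R(G,[M])` whose normalizer in `Perm(G)` lies in `W`. -/
def regularNormalizedWithin (G M : Type*) [Group G] [Group M]
    (W : Subgroup (Equiv.Perm G)) : Set (Subgroup (Equiv.Perm G)) :=
  {N | N ∈ regularNormalizedOfType G M ∧ Subgroup.normalizer N ≤ W}

/-- The subgroup `W(X,Y)` of `Perm(Z)`, for a splitting `{X,Y}` of `Z`: the permutations that
either map `X` to `X` and `Y` to `Y`, or interchange `X` and `Y`. As an abstract group it is the
wreath product `(Perm(X) × Perm(Y)) ⋊ ⟨τ⟩`, with `τ` induced by any bijection `X → Y`. -/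
def wreathSubgroup {Z : Type*} (X Y : Set Z) : Subgroup (Equiv.Perm Z) where
  carrier := {w | (w '' X = X ∧ w '' Y = Y) ∨ (w '' X = Y ∧ w '' Y = X)}
  one_mem' := by simp
  mul_mem' := by
    rintro a b (⟨ha, ha'⟩ | ⟨ha, ha'⟩) (⟨hb, hb'⟩ | ⟨hb, hb'⟩) <;>
      simp [Equiv.Perm.coe_mul, Set.image_comp, ha, ha', hb, hb']
  inv_mem' := by
    have key : ∀ (a : Equiv.Perm Z) (S T : Set Z), a '' S = T → (a⁻¹ : Equiv.Perm Z) '' T = S := by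
      rintro a S T rfl
      ext z
      simp
    rintro a (⟨h, h'⟩ | ⟨h, h'⟩)
    · exact Or.inl ⟨key a _ _ h, key a _ _ h'⟩
    · exact Or.inr ⟨key a _ _ h', key a _ _ h⟩

/-- `X₀ = {1, x, …, xⁿ⁻¹} ⊆ D_n`; here `x = r 1`. -/
def dihedralX₀ (n : ℕ) : Set (DihedralGroup n) := Set.range DihedralGroup.r

/-- `Y₀ = {t, tx, …, txⁿ⁻¹} ⊆ D_n`; here `t = sr 0` and `txⁱ = sr i`. -/
def dihedralY₀ (n : ℕ) : Set (DihedralGroup n) := Set.range DihedralGroup.sr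

/-- `Υ_n = {u ∈ U_n | u² = 1}`, with `U_n` the group of units modulo `n`. -/
def Upsilon (n : ℕ) : Set (ZMod n)ˣ := {u | u ^ 2 = 1}

/-- `μ_n = |{v ∈ Υ_n | gcd(v + 1, n) = 2}|`. -/
noncomputable def muCount (n : ℕ) : ℕ :=
  {v : (ZMod n)ˣ | v ∈ Upsilon n ∧ Nat.gcd ((v : ZMod n).val + 1) n = 2}.ncard

/-!
Every regular `N ≅ D_n` in `Perm(D_n)` has the form `Φ⁻¹ λ(D_n) Φ` for some permutation `Φ`
(`exists_eq_conjRegular`), and `Φ` matters only up to left multiplication by the holomorph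
`Hol(D_n) = Norm(λ(D_n))` (`conjRegular_eq_iff`). For `n ≥ 3` the holomorph is explicit: it consists
of the maps `r a ↦ r (u a + c)`, `sr b ↦ sr (u b + d)` and their versions interchanging rotations
and reflections (`mem_normalizer_leftRegular_dihedral`). So everything is a question about `Φ`:

* `N` is normalized by `λ(D_n)` iff `Φ λ(D_n) Φ⁻¹ ≤ Hol(D_n)`.
* `Norm(N) ≤ W(X₀, Y₀)` iff `Φ ∈ W(X₀, Y₀)`, because `{X₀, Y₀}` is the only system of two blocks
  preserved by `Hol(D_n)` (`normalizer_conjRegular_le_wreathSubgroup_iff`). For odd `n` this holds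
  whenever `N` is normalized by `λ(D_n)`, as the rotation `r 1` has odd order.

If both conditions hold, then after multiplying by an element of the holomorph
`Φ (r a) = r (g a)` and `Φ (sr a) = sr (w (g a))`, where `w² = 1`, `g 0 = 0` and
`g (a + 1) = u g a + 1` with `u² = 1`; conjugation by `λ(r 1)` and by `λ(sr 0)` raises the rotations
of `N` to the powers `u` and `-w`. Conversely each such pair `(g, w)` gives a member of the set, and distinct pairs give
distinct members (`regularNormalizedWithin_eq_image`, `conjRegular_dihedralTwist_injOn`).

It remains to decide for which `u ∈ Υ_n` the solution of `g 0 = 0`, `g (a + 1) = u g a + 1` is a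
well-defined permutation of `ZMod n`. Since `g (2 k) = k (u + 1)`, this forces `u = 1` for odd `n`
and is equivalent to `gcd (u + 1, n) = 2` for even `n`. In the even case `u² = 1` then leaves only
`u = 1` and, when `8 ∣ n`, also `u = 1 + n / 2`.
-/

open DihedralGroup

/-! ### Conjugates of the left regular representation -/

theorem mem_leftRegular {G : Type*} [Group G] {σ : Equiv.Perm G} :
    σ ∈ leftRegular G ↔ ∃ g, ∀ h, σ h = g * h := by
  constructor
  · rintro ⟨g, rfl⟩
    exact ⟨g, fun h => rfl⟩
  · rintro ⟨g, hg⟩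
    exact ⟨g, Equiv.ext fun h => (hg h).symm⟩

/-- The conjugate `Φ⁻¹ λ(G) Φ` of the left regular representation, written as a comap. -/
def conjRegular {G : Type*} [Group G] (Φ : Equiv.Perm G) : Subgroup (Equiv.Perm G) :=
  (leftRegular G).comap (MulAut.conj Φ).toMonoidHom

theorem mem_conjRegular {G : Type*} [Group G] {Φ σ : Equiv.Perm G} :
    σ ∈ conjRegular Φ ↔ Φ * σ * Φ⁻¹ ∈ leftRegular G := Iff.rfl

theorem mem_normalizer_conjRegular {G : Type*} [Group G] {Φ σ : Equiv.Perm G} :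
    σ ∈ Subgroup.normalizer (conjRegular Φ) ↔
      Φ * σ * Φ⁻¹ ∈ Subgroup.normalizer (leftRegular G) := by
  have h := Subgroup.comap_normalizer_eq_of_surjective (leftRegular G)
    (f := (MulAut.conj Φ).toMonoidHom) (MulAut.conj Φ).surjective
  rw [conjRegular, ← h]
  rfl

theorem conjRegular_eq_iff {G : Type*} [Group G] {Φ Ψ : Equiv.Perm G} :
    conjRegular Φ = conjRegular Ψ ↔ Ψ * Φ⁻¹ ∈ Subgroup.normalizer (leftRegular G) := by
  rw [Subgroup.mem_normalizer_iff]
  constructor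
  · intro h σ
    have := SetLike.ext_iff.mp h (Φ⁻¹ * σ * Φ)
    rw [mem_conjRegular, mem_conjRegular] at this
    convert this using 2 <;> group
  · intro h
    ext σ
    rw [mem_conjRegular, mem_conjRegular, h]
    apply iff_of_eq
    congr 1
    group

theorem isRegularSubgroup_conjRegular {G : Type*} [Group G] (Φ : Equiv.Perm G) :
    IsRegularSubgroup (conjRegular Φ) := by
  constructor
  · intro a b
    refine ⟨Φ⁻¹ * MulAction.toPermHom G G (Φ b * (Φ a)⁻¹) * Φ, ?_, ?_⟩
    · rw [mem_conjRegular]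
      refine ⟨Φ b * (Φ a)⁻¹, ?_⟩
      group
    · simp
  · rintro σ hσ ⟨z, hz⟩
    obtain ⟨g, hg⟩ := mem_leftRegular.mp (mem_conjRegular.mp hσ)
    have h1 : g = 1 := by
      have := hg (Φ z)
      simp [hz] at this
      exact this
    ext w
    have := hg (Φ w)
    simpa [h1] using this

theorem nonempty_conjRegular_mulEquiv {G : Type*} [Group G] (Φ : Equiv.Perm G) :
    Nonempty (conjRegular Φ ≃* G) := by
  have hinj : Function.Injective (MulAction.toPermHom G G) := MulAction.toPerm_injective
  have e1 : G ≃* leftRegular G := MonoidHom.ofInjective hinj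
  have h : conjRegular Φ = (leftRegular G).map (MulAut.conj Φ).symm.toMonoidHom :=
    Subgroup.comap_equiv_eq_map_symm (MulAut.conj Φ) (leftRegular G)
  rw [h]
  exact ⟨((leftRegular G).equivMapOfInjective _ (MulAut.conj Φ).symm.injective).symm.trans e1.symm⟩

/-- Two isomorphic regular permutation groups are conjugate; here one of them is `λ(G)`. -/
theorem exists_eq_conjRegular {G : Type*} [Group G] {N : Subgroup (Equiv.Perm G)}
    (hN : IsRegularSubgroup N) (e : N ≃* G) : ∃ Φ, N = conjRegular Φ := by
  have hbij : Function.Bijective (fun g : G => (e.symm g : Equiv.Perm G) 1) := by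
    constructor
    · intro g h hgh
      have h1 := hN.2 ((e.symm g)⁻¹ * e.symm h : N) (SetLike.coe_mem _) ⟨1, by
        simp only [Subgroup.coe_mul, Subgroup.coe_inv, Equiv.Perm.mul_apply]
        rw [Equiv.Perm.inv_eq_iff_eq]
        exact hgh.symm⟩
      have h2 : (e.symm g)⁻¹ * e.symm h = 1 := Subtype.ext h1
      exact e.symm.injective (inv_mul_eq_one.mp h2)
    · intro b
      obtain ⟨σ, hσ, hb⟩ := hN.1 1 b
      exact ⟨e ⟨σ, hσ⟩, by simpa using hb⟩
  let Ψ : Equiv.Perm G := Equiv.ofBijective _ hbij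
  have hΨ : ∀ g h, Ψ (g * h) = (e.symm g : Equiv.Perm G) (Ψ h) := by
    intro g h
    simp [Ψ]
  have key : ∀ σ : N, ∀ h, (σ : Equiv.Perm G) (Ψ h) = Ψ (e σ * h) := by
    intro σ h
    rw [hΨ]; simp
  refine ⟨Ψ⁻¹, ?_⟩
  ext σ
  rw [mem_conjRegular, mem_leftRegular]
  constructor
  · intro hσ
    refine ⟨e ⟨σ, hσ⟩, fun h => ?_⟩
    have := key ⟨σ, hσ⟩ h
    simp only [inv_inv, Equiv.Perm.mul_apply, Equiv.Perm.inv_eq_iff_eq]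
    exact this
  · rintro ⟨g, hg⟩
    have : σ = e.symm g := by
      ext z
      obtain ⟨h, rfl⟩ := Ψ.surjective z
      have := hg h
      simp only [inv_inv, Equiv.Perm.mul_apply, Equiv.Perm.inv_eq_iff_eq] at this
      rw [this, hΨ]
    rw [this]
    exact SetLike.coe_mem _

/-- The normalizer of `λ(G)` is the holomorph: it consists of the products of a left translation
and an automorphism. -/
theorem mem_normalizer_leftRegular {G : Type*} [Group G] {σ : Equiv.Perm G} :
    σ ∈ Subgroup.normalizer (leftRegular G) ↔
      ∃ (g : G) (φ : G ≃* G), ∀ h, σ h = g * φ h := by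
  rw [Subgroup.mem_normalizer_iff]
  constructor
  · intro hσ
    have h1 : ∀ g, ∃ g', ∀ h, σ (g * h) = g' * σ h := by
      intro g
      obtain ⟨g', hg'⟩ := mem_leftRegular.mp ((hσ (MulAction.toPermHom G G g)).mp ⟨g, rfl⟩)
      refine ⟨g', fun h => ?_⟩
      simpa using hg' (σ h)
    refine ⟨σ 1, MulEquiv.mk' (σ.trans (Equiv.mulLeft (σ 1)⁻¹)) ?_, ?_⟩
    · intro a b
      obtain ⟨g', hg'⟩ := h1 a
      have h2 := hg' 1
      rw [mul_one] at h2
      change (σ 1)⁻¹ * σ (a * b) = (σ 1)⁻¹ * σ a * ((σ 1)⁻¹ * σ b)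
      rw [hg' b, h2]
      group
    · intro h
      exact (mul_inv_cancel_left (σ 1) (σ h)).symm
  · rintro ⟨g, φ, h⟩ τ
    rw [mem_leftRegular, mem_leftRegular]
    constructor
    · rintro ⟨a, ha⟩
      refine ⟨g * φ a * g⁻¹, fun b => ?_⟩
      obtain ⟨c, rfl⟩ := σ.surjective b
      simp only [Equiv.Perm.mul_apply, Equiv.Perm.inv_def, Equiv.symm_apply_apply]
      simp [ha, h, mul_assoc]
    · rintro ⟨a, ha⟩
      refine ⟨φ.symm (g⁻¹ * a * g), fun b => σ.injective ?_⟩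
      have := ha (σ b)
      simp only [Equiv.Perm.mul_apply, Equiv.Perm.inv_def, Equiv.symm_apply_apply] at this
      rw [this]
      simp [h, mul_assoc]

/-! ### The holomorph of the dihedral group -/

/-- The automorphism `r a ↦ r (u a)`, `sr b ↦ sr (u b + d)` of the dihedral group. -/
def dihedralAut {n : ℕ} (u : (ZMod n)ˣ) (d : ZMod n) : DihedralGroup n ≃* DihedralGroup n where
  toFun
    | r a => r ((u : ZMod n) * a)
    | sr b => sr ((u : ZMod n) * b + d)
  invFun
    | r a => r ((u⁻¹ : (ZMod n)ˣ) * a)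
    | sr b => sr ((u⁻¹ : (ZMod n)ˣ) * (b - d))
  left_inv := by rintro (a | b) <;> simp
  right_inv := by rintro (a | b) <;> simp
  map_mul' := by rintro (a | b) (c | e) <;> simp <;> ring

@[simp] theorem dihedralAut_r {n : ℕ} (u : (ZMod n)ˣ) (d a : ZMod n) :
    dihedralAut u d (r a) = r ((u : ZMod n) * a) := rfl

@[simp] theorem dihedralAut_sr {n : ℕ} (u : (ZMod n)ˣ) (d b : ZMod n) :
    dihedralAut u d (sr b) = sr ((u : ZMod n) * b + d) := rfl

theorem exists_eq_dihedralAut {n : ℕ} (hn : 3 ≤ n)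
    (φ : DihedralGroup n ≃* DihedralGroup n) : ∃ u d, φ = dihedralAut u d := by
  have hrot : ∀ ψ : DihedralGroup n ≃* DihedralGroup n, ∃ c : ZMod n, ∀ a, ψ (r a) = r (c * a) := by
    intro ψ
    have h1 : orderOf (ψ (r 1)) = n := by rw [MulEquiv.orderOf_eq, orderOf_r_one]
    rcases h : ψ (r 1) with c | c
    · refine ⟨c, fun a => ?_⟩
      have : NeZero n := ⟨by omega⟩
      obtain ⟨k, rfl⟩ := ZMod.natCast_zmod_surjective a
      rw [← r_one_pow, map_pow, h, r_pow]
    · rw [h, orderOf_sr] at h1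
      omega
  obtain ⟨c, hc⟩ := hrot φ
  obtain ⟨c', hc'⟩ := hrot φ.symm
  have hcc : c' * c = 1 := by
    have : φ.symm (φ (r 1)) = r 1 := by simp
    rw [hc, hc'] at this
    simpa using this
  rcases h : φ (sr 0) with d | d
  · -- the preimage of a rotation is a rotation
    have : φ.symm (r d) = sr 0 := by rw [← h]; simp
    rw [hc'] at this
    cases this
  · refine ⟨⟨c, c', by rw [mul_comm, hcc], hcc⟩, d, MulEquiv.ext ?_⟩
    rintro (a | b)
    · simp [hc]
    · have : (sr b : DihedralGroup n) = sr 0 * r b := by simp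
      rw [this, map_mul, h, hc]
      simp [add_comm]

theorem mem_normalizer_leftRegular_dihedral {n : ℕ} (hn : 3 ≤ n)
    {σ : Equiv.Perm (DihedralGroup n)} :
    σ ∈ Subgroup.normalizer (leftRegular (DihedralGroup n)) ↔
      ∃ (u : (ZMod n)ˣ) (c d : ZMod n),
        ((∀ a, σ (r a) = r ((u : ZMod n) * a + c)) ∧ ∀ b, σ (sr b) = sr ((u : ZMod n) * b + d)) ∨
        ((∀ a, σ (r a) = sr ((u : ZMod n) * a + c)) ∧ ∀ b, σ (sr b) = r ((u : ZMod n) * b + d)) := by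
  rw [mem_normalizer_leftRegular]
  constructor
  · rintro ⟨g | g, φ, h⟩
    · obtain ⟨u, d, rfl⟩ := exists_eq_dihedralAut hn φ
      refine ⟨u, g, d - g, Or.inl ⟨fun a => ?_, fun b => ?_⟩⟩
      · simp [h, add_comm]
      · simp [h, add_sub_assoc]
    · obtain ⟨u, d, rfl⟩ := exists_eq_dihedralAut hn φ
      refine ⟨u, g, d - g, Or.inr ⟨fun a => ?_, fun b => ?_⟩⟩
      · simp [h, add_comm]
      · simp [h, add_sub_assoc]
  · rintro ⟨u, c, d, ⟨h1, h2⟩ | ⟨h1, h2⟩⟩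
    · refine ⟨r c, dihedralAut u (d + c), ?_⟩
      rintro (a | b)
      · simp [h1, add_comm]
      · simp [h2, ← add_assoc]
    · refine ⟨sr c, dihedralAut u (d + c), ?_⟩
      rintro (a | b)
      · simp [h1, add_comm]
      · simp [h2, ← add_assoc]

/-! ### The partition into rotations and reflections -/

/-- Whether an element of the dihedral group is a reflection `sr i`. -/
def isReflection {n : ℕ} : DihedralGroup n → Bool
  | r _ => false
  | sr _ => true

@[simp] theorem isReflection_r {n : ℕ} (a : ZMod n) : isReflection (r a) = false := rfl

@[simp] theorem isReflection_sr {n : ℕ} (a : ZMod n) : isReflection (sr a) = true := rfl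

theorem mem_dihedralX₀ {n : ℕ} {g : DihedralGroup n} :
    g ∈ dihedralX₀ n ↔ isReflection g = false := by
  cases g <;> simp [dihedralX₀]

theorem mem_dihedralY₀ {n : ℕ} {g : DihedralGroup n} :
    g ∈ dihedralY₀ n ↔ isReflection g = true := by
  cases g <;> simp [dihedralY₀]

theorem mem_wreathSubgroup_dihedral {n : ℕ} {w : Equiv.Perm (DihedralGroup n)} :
    w ∈ wreathSubgroup (dihedralX₀ n) (dihedralY₀ n) ↔
      ∃ s : Bool, ∀ g, isReflection (w g) = (s ^^ isReflection g) := by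
  change (w '' dihedralX₀ n = dihedralX₀ n ∧ w '' dihedralY₀ n = dihedralY₀ n) ∨
    (w '' dihedralX₀ n = dihedralY₀ n ∧ w '' dihedralY₀ n = dihedralX₀ n) ↔ _
  have him : ∀ s t : Bool, w '' {g | isReflection g = s} = {g | isReflection g = t} ↔
      ∀ g, isReflection g = s ↔ isReflection (w g) = t := by
    intro s t
    rw [Set.ext_iff, w.surjective.forall]
    simp
  have hX : dihedralX₀ n = {g | isReflection g = false} := Set.ext fun _ => mem_dihedralX₀
  have hY : dihedralY₀ n = {g | isReflection g = true} := Set.ext fun _ => mem_dihedralY₀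
  rw [hX, hY, him, him, him, him, Bool.exists_bool]
  refine or_congr ⟨fun h g => ?_, fun h => ⟨fun g => ?_, fun g => ?_⟩⟩
    ⟨fun h g => ?_, fun h => ⟨fun g => ?_, fun g => ?_⟩⟩
  · have h1 := h.1 g; have h2 := h.2 g
    revert h1 h2; cases isReflection g <;> simp
  · simp [h g]
  · simp [h g]
  · have h1 := h.1 g; have h2 := h.2 g
    revert h1 h2; cases isReflection g <;> simp
  · simp [h g]
  · simp [h g]

theorem ZMod.apply_eq_apply_zero {n : ℕ} [NeZero n] {α : Type*} {f : ZMod n → α}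
    (h : ∀ a, f (a + 1) = f a) (a : ZMod n) : f a = f 0 := by
  obtain ⟨k, rfl⟩ := ZMod.natCast_zmod_surjective a
  induction k with
  | zero => simp
  | succ k ih => rw [Nat.cast_succ, h, ih]

theorem mem_wreathSubgroup_of_forall_add_one {n : ℕ} [NeZero n]
    {w : Equiv.Perm (DihedralGroup n)}
    (hr : ∀ a, isReflection (w (r (a + 1))) = isReflection (w (r a)))
    (hs : ∀ a, isReflection (w (sr (a + 1))) = isReflection (w (sr a))) :
    w ∈ wreathSubgroup (dihedralX₀ n) (dihedralY₀ n) := by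
  rw [mem_wreathSubgroup_dihedral]
  have hr' := ZMod.apply_eq_apply_zero (f := fun a => isReflection (w (r a))) hr
  have hs' := ZMod.apply_eq_apply_zero (f := fun a => isReflection (w (sr a))) hs
  have hne : isReflection (w (sr 0)) = !isReflection (w (r 0)) := by
    -- otherwise all values of `w` lie in the same part
    by_contra hne
    have heq : isReflection (w (sr 0)) = isReflection (w (r 0)) := by
      revert hne
      cases isReflection (w (sr 0)) <;> cases isReflection (w (r 0)) <;> simp
    have hall : ∀ g, isReflection (w g) = isReflection (w (r 0)) := by
      rintro (a | a)
      · exact hr' a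
      · exact (hs' a).trans heq
    obtain ⟨g, hg⟩ := w.surjective (r 0)
    obtain ⟨g', hg'⟩ := w.surjective (sr 0)
    have h1 := (hall g).trans (hall g').symm
    rw [hg, hg'] at h1
    exact Bool.false_ne_true h1
  refine ⟨isReflection (w (r 0)), ?_⟩
  rintro (a | a)
  · simpa using hr' a
  · rw [isReflection_sr, Bool.xor_true, ← hne]
    exact hs' a

theorem normalizer_leftRegular_le_wreathSubgroup {n : ℕ} (hn : 3 ≤ n) :
    Subgroup.normalizer (leftRegular (DihedralGroup n)) ≤
      wreathSubgroup (dihedralX₀ n) (dihedralY₀ n) := by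
  intro σ hσ
  rw [mem_wreathSubgroup_dihedral]
  obtain ⟨u, c, d, ⟨h1, h2⟩ | ⟨h1, h2⟩⟩ := (mem_normalizer_leftRegular_dihedral hn).mp hσ
  · refine ⟨false, ?_⟩
    rintro (a | a) <;> simp [h1, h2]
  · refine ⟨true, ?_⟩
    rintro (a | a) <;> simp [h1, h2]

/-- The block system `{X₀, Y₀}` is the only one with two blocks that the whole holomorph
preserves. -/
theorem normalizer_conjRegular_le_wreathSubgroup_iff {n : ℕ} (hn : 3 ≤ n)
    {Φ : Equiv.Perm (DihedralGroup n)} :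
    Subgroup.normalizer (conjRegular Φ) ≤ wreathSubgroup (dihedralX₀ n) (dihedralY₀ n) ↔
      Φ ∈ wreathSubgroup (dihedralX₀ n) (dihedralY₀ n) := by
  have : NeZero n := ⟨by omega⟩
  constructor
  · intro h
    have hq : ∀ η : Equiv.Perm (DihedralGroup n),
        η ∈ Subgroup.normalizer (leftRegular (DihedralGroup n)) →
        ∃ s : Bool, ∀ g, isReflection (Φ⁻¹ (η g)) = (s ^^ isReflection (Φ⁻¹ g)) := by
      intro η hη
      have h1 : Φ⁻¹ * η * Φ ∈ Subgroup.normalizer (conjRegular Φ) := by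
        rw [mem_normalizer_conjRegular]
        convert hη using 1
        group
      obtain ⟨s, hs⟩ := mem_wreathSubgroup_dihedral.mp (h h1)
      refine ⟨s, fun g => ?_⟩
      simpa using hs (Φ⁻¹ g)
    -- an automorphism fixes the identity, hence both parts
    obtain ⟨s, hs⟩ := hq (dihedralAut 1 1).toEquiv
      (mem_normalizer_leftRegular.mpr ⟨1, dihedralAut 1 1, fun h => by simp⟩)
    obtain rfl : s = false := by
      have := hs (r 0)
      revert this
      cases s <;> simp
    have hsr : ∀ a, isReflection (Φ⁻¹ (sr (a + 1))) = isReflection (Φ⁻¹ (sr a)) := by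
      intro a
      simpa using hs (sr a)
    obtain ⟨t, ht⟩ := hq (MulAction.toPermHom _ _ (r 1))
      (Subgroup.le_normalizer ⟨r 1, rfl⟩)
    obtain rfl : t = false := by
      have h1 := ht (sr (0 + 1))
      have h2 := hsr 0
      simp only [MulAction.toPermHom_apply, MulAction.toPerm_apply, smul_eq_mul, r_mul_sr,
        add_sub_cancel_right] at h1
      rw [h2] at h1
      revert h1
      cases t <;> simp
    rw [← inv_mem_iff]
    refine mem_wreathSubgroup_of_forall_add_one (fun a => ?_) hsr
    have := ht (r a)
    simp only [MulAction.toPermHom_apply, MulAction.toPerm_apply, smul_eq_mul, r_mul_r,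
      Bool.false_xor] at this
    rw [add_comm, this]
  · intro hΦ σ hσ
    have h1 := normalizer_leftRegular_le_wreathSubgroup hn (mem_normalizer_conjRegular.mp hσ)
    have h2 := mul_mem (mul_mem (inv_mem hΦ) h1) hΦ
    convert h2 using 1
    group

/-- For odd `n` the translation by the rotation `r 1` has odd order, so it cannot interchange two
blocks. -/
theorem mem_wreathSubgroup_of_odd {n : ℕ} (hn : 3 ≤ n) (hodd : Odd n)
    {Φ : Equiv.Perm (DihedralGroup n)}
    (h : leftRegular (DihedralGroup n) ≤ Subgroup.normalizer (conjRegular Φ)) :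
    Φ ∈ wreathSubgroup (dihedralX₀ n) (dihedralY₀ n) := by
  have : NeZero n := ⟨by omega⟩
  obtain ⟨s, hs⟩ := mem_wreathSubgroup_dihedral.mp (normalizer_leftRegular_le_wreathSubgroup hn
    (mem_normalizer_conjRegular.mp (h (⟨r 1, rfl⟩ :
      MulAction.toPermHom (DihedralGroup n) (DihedralGroup n) (r 1) ∈ leftRegular _))))
  have hs' : ∀ g, isReflection (Φ (r 1 * g)) = (s ^^ isReflection (Φ g)) := by
    intro g
    simpa using hs (Φ g)
  have hk : ∀ k : ℕ, isReflection (Φ (r (k : ZMod n))) =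
      ((decide (Odd k) && s) ^^ isReflection (Φ (r 0))) := by
    intro k
    induction k with
    | zero => simp
    | succ k ih =>
      have h1 := hs' (r (k : ZMod n))
      rw [r_mul_r, ih] at h1
      rw [Nat.cast_succ, add_comm, h1]
      by_cases hk : Odd k <;> cases s <;> simp [Nat.odd_add_one, hk]
  have hn0 := hk n
  obtain rfl : s = false := by
    revert hn0
    cases s <;> simp [hodd]
  refine mem_wreathSubgroup_of_forall_add_one (fun a => ?_) (fun a => ?_)
  · have := hs' (r a)
    simpa [add_comm] using this
  · have := hs' (sr (a + 1))
    simpa using this.symm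

/-! ### The classification -/

/-- The permutations `g` of `ZMod n` with `g 0 = 0` that conjugate `a ↦ a + 1` to an affine map
`a ↦ u a + 1` whose multiplier satisfies `u² = 1`. -/
def affineCoordinates (n : ℕ) : Set (Equiv.Perm (ZMod n)) :=
  {g | g 0 = 0 ∧ ∃ u ∈ Upsilon n, ∀ a, g (a + 1) = (u : ZMod n) * g a + 1}

/-- The permutation `r a ↦ r (g a)`, `sr a ↦ sr (w (g a))` of the dihedral group. -/
def dihedralTwist {n : ℕ} (g : Equiv.Perm (ZMod n)) (w : (ZMod n)ˣ) :
    Equiv.Perm (DihedralGroup n) where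
  toFun
    | r a => r (g a)
    | sr a => sr (w * g a)
  invFun
    | r a => r (g.symm a)
    | sr a => sr (g.symm ((w⁻¹ : (ZMod n)ˣ) * a))
  left_inv := by rintro (a | a) <;> simp
  right_inv := by rintro (a | a) <;> simp

@[simp] theorem dihedralTwist_r {n : ℕ} (g : Equiv.Perm (ZMod n)) (w : (ZMod n)ˣ) (a : ZMod n) :
    dihedralTwist g w (r a) = r (g a) := rfl

@[simp] theorem dihedralTwist_sr {n : ℕ} (g : Equiv.Perm (ZMod n)) (w : (ZMod n)ˣ) (a : ZMod n) :
    dihedralTwist g w (sr a) = sr ((w : ZMod n) * g a) := rfl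

theorem dihedralTwist_mem_wreathSubgroup {n : ℕ} (g : Equiv.Perm (ZMod n)) (w : (ZMod n)ˣ) :
    dihedralTwist g w ∈ wreathSubgroup (dihedralX₀ n) (dihedralY₀ n) := by
  rw [mem_wreathSubgroup_dihedral]
  refine ⟨false, ?_⟩
  rintro (a | a) <;> simp

theorem Equiv.Perm.conj_apply_apply {α : Type*} (Φ σ : Equiv.Perm α) (x : α) :
    (Φ * σ * Φ⁻¹) (Φ x) = Φ (σ x) := by simp

theorem coe_sq_of_mem_Upsilon {n : ℕ} {u : (ZMod n)ˣ} (hu : u ∈ Upsilon n) :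
    (u : ZMod n) * u = 1 := by
  have : u ^ 2 = 1 := hu
  rw [← Units.val_mul, ← sq, this, Units.val_one]

/-- It suffices to check the generators `r 1` and `sr 0`. -/
theorem leftRegular_le_normalizer_conjRegular_iff {n : ℕ} [NeZero n]
    {Φ : Equiv.Perm (DihedralGroup n)} :
    leftRegular (DihedralGroup n) ≤ Subgroup.normalizer (conjRegular Φ) ↔
      Φ * MulAction.toPermHom (DihedralGroup n) (DihedralGroup n) (r 1) * Φ⁻¹ ∈
        Subgroup.normalizer (leftRegular (DihedralGroup n)) ∧
      Φ * MulAction.toPermHom (DihedralGroup n) (DihedralGroup n) (sr 0) * Φ⁻¹ ∈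
        Subgroup.normalizer (leftRegular (DihedralGroup n)) := by
  simp only [← mem_normalizer_conjRegular]
  constructor
  · intro h
    exact ⟨h ⟨_, rfl⟩, h ⟨_, rfl⟩⟩
  · rintro ⟨h1, h2⟩ _ ⟨x, rfl⟩
    have hr : ∀ a, MulAction.toPermHom (DihedralGroup n) (DihedralGroup n) (r a) ∈
        Subgroup.normalizer (conjRegular Φ) := by
      intro a
      obtain ⟨k, rfl⟩ := ZMod.natCast_zmod_surjective a
      rw [← r_one_pow, map_pow]
      exact pow_mem h1 k
    rcases x with a | a
    · exact hr a
    · have : (sr a : DihedralGroup n) = sr 0 * r a := by simp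
      rw [this, map_mul]
      exact mul_mem h2 (hr a)

theorem leftRegular_le_normalizer_dihedralTwist {n : ℕ} (hn : 3 ≤ n) {g : Equiv.Perm (ZMod n)}
    (hg : g ∈ affineCoordinates n) {w : (ZMod n)ˣ} (hw : w ∈ Upsilon n) :
    leftRegular (DihedralGroup n) ≤ Subgroup.normalizer (conjRegular (dihedralTwist g w)) := by
  have : NeZero n := ⟨by omega⟩
  obtain ⟨-, u, hu, hgu⟩ := hg
  have hu' := coe_sq_of_mem_Upsilon hu
  have hw' := coe_sq_of_mem_Upsilon hw
  rw [leftRegular_le_normalizer_conjRegular_iff]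
  constructor
  · refine (mem_normalizer_leftRegular_dihedral hn).mpr ⟨u, 1, -(w * u), Or.inl ⟨?_, ?_⟩⟩
    · intro a
      obtain ⟨b, rfl⟩ := g.surjective a
      have h1 : (r (g b) : DihedralGroup n) = dihedralTwist g w (r b) := rfl
      rw [h1, Equiv.Perm.conj_apply_apply]
      simp [add_comm (1 : ZMod n), hgu]
    · intro a
      obtain ⟨b, rfl⟩ : ∃ b, a = w * g b := by
        obtain ⟨b, hb⟩ := g.surjective (w * a)
        exact ⟨b, by rw [hb, ← mul_assoc, hw', one_mul]⟩
      have h1 : (sr ((w : ZMod n) * g b) : DihedralGroup n) = dihedralTwist g w (sr b) := rfl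
      rw [h1, Equiv.Perm.conj_apply_apply]
      have h2 := hgu (b - 1)
      rw [sub_add_cancel] at h2
      have h3 : g (b - 1) = u * g b - u := by
        rw [h2]
        linear_combination (-g (b - 1)) * hu'
      simp only [MulAction.toPermHom_apply, MulAction.toPerm_apply, smul_eq_mul, r_mul_sr,
        dihedralTwist_sr, sr.injEq, h3]
      ring
  · refine (mem_normalizer_leftRegular_dihedral hn).mpr ⟨w, 0, 0, Or.inr ⟨?_, ?_⟩⟩
    · intro a
      obtain ⟨b, rfl⟩ := g.surjective a
      have h1 : (r (g b) : DihedralGroup n) = dihedralTwist g w (r b) := rfl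
      rw [h1, Equiv.Perm.conj_apply_apply]
      simp
    · intro a
      obtain ⟨b, rfl⟩ : ∃ b, a = w * g b := by
        obtain ⟨b, hb⟩ := g.surjective (w * a)
        exact ⟨b, by rw [hb, ← mul_assoc, hw', one_mul]⟩
      have h1 : (sr ((w : ZMod n) * g b) : DihedralGroup n) = dihedralTwist g w (sr b) := rfl
      rw [h1, Equiv.Perm.conj_apply_apply]
      simp [← mul_assoc, hw']

theorem conjRegular_dihedralTwist_injOn {n : ℕ} (hn : 3 ≤ n) :
    Set.InjOn (fun p : Equiv.Perm (ZMod n) × (ZMod n)ˣ => conjRegular (dihedralTwist p.1 p.2))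
      (affineCoordinates n ×ˢ Upsilon n) := by
  rintro ⟨g, w⟩ ⟨⟨hg0, u, -, hg⟩, -⟩ ⟨g', w'⟩ ⟨⟨hg0', u', -, hg'⟩, -⟩ h
  have h1 := conjRegular_eq_iff.mp h
  have hg1 : g 1 = 1 := by simpa [hg0] using hg 0
  have hg1' : g' 1 = 1 := by simpa [hg0'] using hg' 0
  -- `η` is the element of the holomorph relating the two coordinate systems
  generalize hη : dihedralTwist g' w' * (dihedralTwist g w)⁻¹ = η at h1
  have hη' : ∀ x, η (dihedralTwist g w x) = dihedralTwist g' w' x := by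
    intro x
    rw [← hη]
    simp
  obtain ⟨s, c, d, ⟨hr, hs⟩ | ⟨hr, -⟩⟩ := (mem_normalizer_leftRegular_dihedral hn).mp h1
  · have e1 : ∀ a, (s : ZMod n) * g a + c = g' a := fun a => by
      simpa [hr] using hη' (r a)
    have e2 : ∀ a, (s : ZMod n) * (w * g a) + d = w' * g' a := fun a => by
      simpa [hs] using hη' (sr a)
    have hc : c = 0 := by simpa [hg0, hg0'] using e1 0
    have hd : d = 0 := by simpa [hg0, hg0'] using e2 0
    have hs1 : (s : ZMod n) = 1 := by simpa [hg1, hg1', hc] using e1 1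
    have hw : w = w' := Units.ext (by simpa [hg1, hg1', hd, hs1] using e2 1)
    have hgg : g = g' := Equiv.ext fun a => by simpa [hc, hs1] using e1 a
    rw [hw, hgg]
  · have := hη' (r 0)
    rw [dihedralTwist_r, hr] at this
    cases this

/-- If `Φ` interchanges `X₀` and `Y₀`, then `λ(sr 0) Φ` fixes them and conjugates to the same
subgroup. -/
theorem exists_conjRegular_eq_fixing {n : ℕ}
    {Φ : Equiv.Perm (DihedralGroup n)}
    (hΦ : Φ ∈ wreathSubgroup (dihedralX₀ n) (dihedralY₀ n)) :
    ∃ Ψ, conjRegular Ψ = conjRegular Φ ∧ ∀ x, isReflection (Ψ x) = isReflection x := by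
  obtain ⟨s, hs⟩ := mem_wreathSubgroup_dihedral.mp hΦ
  cases s
  · exact ⟨Φ, rfl, fun x => by simpa using hs x⟩
  · refine ⟨MulAction.toPermHom _ _ (sr 0 : DihedralGroup n) * Φ,
      (conjRegular_eq_iff.mpr ?_).symm, fun x => ?_⟩
    · rw [mul_inv_cancel_right]
      exact Subgroup.le_normalizer ⟨_, rfl⟩
    · have h1 : ∀ y : DihedralGroup n,
          isReflection ((sr 0 : DihedralGroup n) * y) = !isReflection y := by
        rintro (a | a) <;> simp
      have h2 := hs x
      simp only [Equiv.Perm.mul_apply, MulAction.toPermHom_apply, MulAction.toPerm_apply,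
        smul_eq_mul, h1, h2]
      simp

/-- An affine recurrence whose orbit is everything can be rescaled to have constant term `1`. -/
theorem exists_mem_affineCoordinates {n : ℕ} [NeZero n] {g : ZMod n → ZMod n}
    (hg : Function.Bijective g) {u : (ZMod n)ˣ} (hu : u ∈ Upsilon n) {c : ZMod n}
    (h : ∀ a, g (a + 1) = u * g a + c) :
    ∃ f ∈ affineCoordinates n, ∃ v : (ZMod n)ˣ, ∀ a, f a = v * (g a - g 0) := by
  -- all differences `g a - g 0` are multiples of `k = g 1 - g 0`, so `k` is a unit
  obtain ⟨k, hk⟩ : ∃ k, g 1 = g 0 + k := ⟨g 1 - g 0, by ring⟩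
  have h0 : g 1 = u * g 0 + c := by simpa using h 0
  have hdvd : ∀ m : ℕ, k ∣ g (m : ZMod n) - g 0 := by
    intro m
    induction m with
    | zero => simp
    | succ m ih =>
      obtain ⟨q, hq⟩ := ih
      refine ⟨u * q + 1, ?_⟩
      rw [Nat.cast_succ, h]
      linear_combination (u : ZMod n) * hq - h0 + hk
  obtain ⟨a, ha⟩ := hg.2 (g 0 + 1)
  obtain ⟨m, rfl⟩ := ZMod.natCast_zmod_surjective a
  have hkunit : IsUnit k := by
    apply isUnit_of_dvd_one
    have := hdvd m
    rwa [ha, add_sub_cancel_left] at this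
  obtain ⟨κ, rfl⟩ := hkunit
  have hf : Function.Bijective fun a => ((κ⁻¹ : (ZMod n)ˣ) : ZMod n) * (g a - g 0) := by
    apply Finite.injective_iff_bijective.mp
    intro x y hxy
    exact hg.1 (sub_left_injective (κ⁻¹.isUnit.mul_right_injective hxy))
  refine ⟨Equiv.ofBijective _ hf, ⟨?_, u, hu, fun a => ?_⟩, κ⁻¹, fun a => rfl⟩
  · simp
  · simp only [Equiv.ofBijective_apply, h]
    have := κ.inv_mul
    linear_combination ((κ⁻¹ : (ZMod n)ˣ) : ZMod n) * (hk - h0) + this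

theorem exists_conjRegular_eq_dihedralTwist {n : ℕ} (hn : 3 ≤ n)
    {Φ : Equiv.Perm (DihedralGroup n)}
    (hΦ : Φ ∈ wreathSubgroup (dihedralX₀ n) (dihedralY₀ n))
    (h : leftRegular (DihedralGroup n) ≤ Subgroup.normalizer (conjRegular Φ)) :
    ∃ g ∈ affineCoordinates n, ∃ w ∈ Upsilon n,
      conjRegular (dihedralTwist g w) = conjRegular Φ := by
  have : NeZero n := ⟨by omega⟩
  obtain ⟨Ψ, hΨ, hfix⟩ := exists_conjRegular_eq_fixing hΦ
  rw [← hΨ] at h ⊢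
  clear hΨ hΦ
  have hr : ∀ a, ∃ b, Ψ (r a) = r b := by
    intro a
    have := hfix (r a)
    rcases hx : Ψ (r a) with b | b
    · exact ⟨b, rfl⟩
    · simp [hx] at this
  have hs : ∀ a, ∃ b, Ψ (sr a) = sr b := by
    intro a
    have := hfix (sr a)
    rcases hx : Ψ (sr a) with b | b
    · simp [hx] at this
    · exact ⟨b, rfl⟩
  choose p hp using hr
  choose q hq using hs
  have hpbij : Function.Bijective p := by
    apply Finite.injective_iff_bijective.mp
    intro a b hab
    have : Ψ (r a) = Ψ (r b) := by rw [hp, hp, hab]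
    simpa using this
  obtain ⟨hrot, hrefl⟩ := leftRegular_le_normalizer_conjRegular_iff.mp h
  -- the translation by `r 1` in the new coordinates
  generalize hρ : Ψ * MulAction.toPermHom (DihedralGroup n) (DihedralGroup n) (r 1) * Ψ⁻¹ = ρ
    at hrot
  have hρ' : ∀ x, ρ (Ψ x) = Ψ (r 1 * x) := fun x => by rw [← hρ]; simp
  -- the translation by `sr 0` in the new coordinates
  generalize hθ : Ψ * MulAction.toPermHom (DihedralGroup n) (DihedralGroup n) (sr 0) * Ψ⁻¹ = θ
    at hrefl
  have hθ' : ∀ x, θ (Ψ x) = Ψ (sr 0 * x) := fun x => by rw [← hθ]; simp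
  obtain ⟨u, c, d, ⟨hρr, hρs⟩ | ⟨hρr, -⟩⟩ := (mem_normalizer_leftRegular_dihedral hn).mp hrot
  swap
  · have := hρ' (r 0)
    simp only [r_mul_r, hp, hρr] at this
    cases this
  obtain ⟨w, e, f, ⟨hθr, -⟩ | ⟨hθr, hθs⟩⟩ := (mem_normalizer_leftRegular_dihedral hn).mp hrefl
  · have := hθ' (r 0)
    simp only [sr_mul_r, hp, hq, hθr] at this
    cases this
  have e1 : ∀ a, p (a + 1) = u * p a + c := by
    intro a
    have := hρ' (r a)
    simp only [r_mul_r, hp, hρr, r.injEq] at this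
    rw [add_comm a, this]
  have e2 : ∀ a, q a = u * q (a + 1) + d := by
    intro a
    have := hρ' (sr (a + 1))
    simp only [r_mul_sr, hq, hρs, sr.injEq, add_sub_cancel_right] at this
    exact this.symm
  have e3 : ∀ a, q a = w * p a + e := by
    intro a
    have := hθ' (r a)
    simp only [sr_mul_r, hp, hq, hθr, sr.injEq, zero_add] at this
    exact this.symm
  have e4 : ∀ a, p a = w * q a + f := by
    intro a
    have := hθ' (sr a)
    simp only [sr_mul_sr, hp, hq, hθs, r.injEq, sub_zero] at this
    exact this.symm
  obtain ⟨x0, hx0⟩ := hpbij.2 0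
  obtain ⟨x1, hx1⟩ := hpbij.2 1
  -- both identities compare an affine map with itself at the points `0` and `1`
  have hww : (w : ZMod n) * w = 1 := by
    have a0 := e4 x0
    have a1 := e4 x1
    rw [e3, hx0] at a0
    rw [e3, hx1] at a1
    linear_combination a0 - a1
  have huu : (u : ZMod n) * u = 1 := by
    have a0 := e2 x0
    have a1 := e2 x1
    rw [e3, e3, e1, hx0] at a0
    rw [e3, e3, e1, hx1] at a1
    linear_combination (1 - (u : ZMod n) * u) * hww + (w : ZMod n) * (a0 - a1)
  have hu : u ∈ Upsilon n := Units.ext (by simpa [sq] using huu)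
  have hw : w ∈ Upsilon n := Units.ext (by simpa [sq] using hww)
  obtain ⟨g, hg, v, hgv⟩ := exists_mem_affineCoordinates hpbij hu e1
  refine ⟨g, hg, w, hw, (conjRegular_eq_iff.mpr ?_).symm⟩
  refine (mem_normalizer_leftRegular_dihedral hn).mpr
    ⟨v, -(v * p 0), -(v * (w * p 0 + e)), Or.inl ⟨fun a => ?_, fun a => ?_⟩⟩
  · obtain ⟨b, rfl⟩ := hpbij.2 a
    rw [← hp]
    simp only [Equiv.Perm.mul_apply, Equiv.Perm.inv_def, Equiv.symm_apply_apply,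
      dihedralTwist_r, hgv]
    congr 1
    ring
  · obtain ⟨b, rfl⟩ : ∃ b, a = q b := by
      obtain ⟨b, hb⟩ := hpbij.2 (w * (a - e))
      refine ⟨b, ?_⟩
      rw [e3, hb]
      linear_combination (e - a) * hww
    rw [← hq]
    simp only [Equiv.Perm.mul_apply, Equiv.Perm.inv_def, Equiv.symm_apply_apply,
      dihedralTwist_sr, hgv]
    rw [e3]
    congr 1
    ring

theorem regularNormalizedWithin_eq_image {n : ℕ} (hn : 3 ≤ n) :
    regularNormalizedWithin (DihedralGroup n) (DihedralGroup n)
        (wreathSubgroup (dihedralX₀ n) (dihedralY₀ n)) =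
      (fun p : Equiv.Perm (ZMod n) × (ZMod n)ˣ => conjRegular (dihedralTwist p.1 p.2)) ''
        (affineCoordinates n ×ˢ Upsilon n) := by
  ext N
  constructor
  · rintro ⟨⟨⟨hreg, hnorm⟩, ⟨e⟩⟩, hW⟩
    obtain ⟨Φ, rfl⟩ := exists_eq_conjRegular hreg e
    obtain ⟨g, hg, w, hw, h⟩ := exists_conjRegular_eq_dihedralTwist hn
      ((normalizer_conjRegular_le_wreathSubgroup_iff hn).mp hW) hnorm
    exact ⟨(g, w), ⟨hg, hw⟩, h⟩
  · rintro ⟨⟨g, w⟩, ⟨hg, hw⟩, rfl⟩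
    exact ⟨⟨⟨isRegularSubgroup_conjRegular _, leftRegular_le_normalizer_dihedralTwist hn hg hw⟩,
      nonempty_conjRegular_mulEquiv _⟩,
      (normalizer_conjRegular_le_wreathSubgroup_iff hn).mpr (dihedralTwist_mem_wreathSubgroup g w)⟩

theorem ncard_regularNormalizedWithin {n : ℕ} (hn : 3 ≤ n) :
    (regularNormalizedWithin (DihedralGroup n) (DihedralGroup n)
        (wreathSubgroup (dihedralX₀ n) (dihedralY₀ n))).ncard =
      (affineCoordinates n).ncard * (Upsilon n).ncard := by
  rw [regularNormalizedWithin_eq_image hn, (conjRegular_dihedralTwist_injOn hn).ncard_image,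
    Set.ncard_prod]

theorem normalizer_le_wreathSubgroup_of_odd {n : ℕ} (hn : 3 ≤ n) (hodd : Odd n)
    {N : Subgroup (Equiv.Perm (DihedralGroup n))}
    (hN : N ∈ regularNormalizedOfType (DihedralGroup n) (DihedralGroup n)) :
    Subgroup.normalizer N ≤ wreathSubgroup (dihedralX₀ n) (dihedralY₀ n) := by
  obtain ⟨⟨hreg, hnorm⟩, ⟨e⟩⟩ := hN
  obtain ⟨Φ, rfl⟩ := exists_eq_conjRegular hreg e
  exact (normalizer_conjRegular_le_wreathSubgroup_iff hn).mpr
    (mem_wreathSubgroup_of_odd hn hodd hnorm)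

/-! ### Counting the coordinate changes -/

theorem ZMod.ext_of_recurrence {n : ℕ} [NeZero n] {g g' : ZMod n → ZMod n} {F : ZMod n → ZMod n}
    (h0 : g 0 = g' 0) (hg : ∀ a, g (a + 1) = F (g a)) (hg' : ∀ a, g' (a + 1) = F (g' a)) :
    g = g' := by
  funext a
  obtain ⟨k, rfl⟩ := ZMod.natCast_zmod_surjective a
  induction k with
  | zero => simpa using h0
  | succ k ih => rw [Nat.cast_succ, hg, hg', ih]

theorem apply_two_mul_of_recurrence {n : ℕ} {g : ZMod n → ZMod n} (h0 : g 0 = 0) {u : (ZMod n)ˣ}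
    (hu : u ∈ Upsilon n) (h : ∀ a, g (a + 1) = (u : ZMod n) * g a + 1) (k : ℕ) :
    g ((2 * k : ℕ) : ZMod n) = k * ((u : ZMod n) + 1) := by
  induction k with
  | zero => simpa using h0
  | succ k ih =>
    have : ((2 * (k + 1) : ℕ) : ZMod n) = ((2 * k : ℕ) : ZMod n) + 1 + 1 := by push_cast; ring
    rw [this, h, h, ih]
    push_cast
    linear_combination (k * ((u : ZMod n) + 1)) * coe_sq_of_mem_Upsilon hu

theorem affineCoordinates_of_odd {n : ℕ} (hn : 3 ≤ n) (hodd : Odd n) :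
    affineCoordinates n = {1} := by
  have : NeZero n := ⟨by omega⟩
  ext g
  constructor
  · rintro ⟨h0, u, hu, hg⟩
    -- every residue is even, so all values of `g` are multiples of `u + 1`
    obtain ⟨a, ha⟩ := g.surjective 1
    obtain ⟨k, rfl⟩ : ∃ k : ℕ, a = ((2 * k : ℕ) : ZMod n) := by
      obtain ⟨m, hm⟩ := hodd
      refine ⟨(m + 1) * a.val, ?_⟩
      have h1 : ((2 * m + 1 : ℕ) : ZMod n) = 0 := by rw [← hm, ZMod.natCast_self]
      push_cast at h1 ⊢
      rw [ZMod.natCast_zmod_val]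
      linear_combination (-a) * h1
    rw [apply_two_mul_of_recurrence h0 hu hg] at ha
    have hu1 : (u : ZMod n) = 1 := by
      linear_combination (k : ZMod n) * coe_sq_of_mem_Upsilon hu + (1 - (u : ZMod n)) * ha
    refine Equiv.ext fun a => congrFun (ZMod.ext_of_recurrence (g := g) (g' := id)
      (F := fun a => a + 1) h0 (fun a => ?_) (fun a => rfl)) a
    rw [hg, hu1, one_mul]
  · rintro rfl
    exact ⟨rfl, 1, one_pow 2, fun a => by simp⟩

theorem val_odd_of_even {n : ℕ} (heven : Even n) (u : (ZMod n)ˣ) : Odd (u : ZMod n).val := by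
  have h := ZMod.val_coe_unit_coprime u
  rw [← Nat.not_even_iff_odd]
  intro h2
  have := Nat.dvd_gcd h2.two_dvd heven.two_dvd
  rw [h] at this
  omega

theorem gcd_val_add_one_eq_two_iff {n : ℕ} (heven : Even n) (u : (ZMod n)ˣ) :
    Nat.gcd ((u : ZMod n).val + 1) n = 2 ↔ Nat.gcd ((u : ZMod n).val + 1) n ∣ 2 := by
  constructor
  · intro h; rw [h]
  · intro h
    exact Nat.dvd_antisymm h (Nat.dvd_gcd (val_odd_of_even heven u).add_one.two_dvd heven.two_dvd)

/-- Modulo `gcd (u + 1, n)` the sequence `g` alternates between `0` and `1`, yet it is onto. -/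
theorem gcd_eq_two_of_mem_affineCoordinates {n : ℕ} (hn : 3 ≤ n) (heven : Even n)
    {g : Equiv.Perm (ZMod n)} (h0 : g 0 = 0) {u : (ZMod n)ˣ} (hu : u ∈ Upsilon n)
    (h : ∀ a, g (a + 1) = (u : ZMod n) * g a + 1) :
    Nat.gcd ((u : ZMod n).val + 1) n = 2 := by
  have : NeZero n := ⟨by omega⟩
  rw [gcd_val_add_one_eq_two_iff heven]
  set δ := Nat.gcd ((u : ZMod n).val + 1) n with hδ
  have hδn : δ ∣ n := Nat.gcd_dvd_right _ _
  -- modulo `δ` the map `g` takes only the values `0` and `1`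
  let π : ZMod n →+* ZMod δ := ZMod.castHom hδn (ZMod δ)
  have hπu : π ((u : ZMod n) + 1) = 0 := by
    have h1 : ((((u : ZMod n).val + 1 : ℕ)) : ZMod n) = (u : ZMod n) + 1 := by
      rw [Nat.cast_succ, ZMod.natCast_zmod_val]
    rw [← h1, map_natCast, ZMod.natCast_eq_zero_iff]
    exact Nat.gcd_dvd_left _ _
  have hval : ∀ a, π (g a) = 0 ∨ π (g a) = 1 := by
    intro a
    obtain ⟨m, rfl⟩ := ZMod.natCast_zmod_surjective a
    obtain ⟨k, rfl | rfl⟩ := Nat.even_or_odd' m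
    · left
      rw [apply_two_mul_of_recurrence h0 hu h, map_mul, hπu, mul_zero]
    · right
      rw [Nat.cast_succ, h, apply_two_mul_of_recurrence h0 hu h]
      simp only [map_add, map_mul, map_one] at hπu ⊢
      rw [hπu]
      ring
  obtain ⟨a, ha⟩ := g.surjective 2
  obtain ⟨b, hb⟩ := g.surjective (-1)
  have h2 := hval a
  have h3 := hval b
  rw [ha] at h2
  rw [hb] at h3
  simp only [map_ofNat, map_neg, map_one] at h2 h3
  rw [← ZMod.natCast_eq_zero_iff, Nat.cast_ofNat]
  rcases h2 with h2 | h2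
  · exact h2
  · rcases h3 with h3 | h3
    · linear_combination (-2 : ZMod δ) * h3
    · linear_combination -h3

/-- The affine permutation `f : x ↦ u x + 1` satisfies `f ^ n = 1`, so `g a = f ^ a 0` is well
defined on `ZMod n`; it is surjective since `f ^ 2` is the translation by `u + 1`, whose multiples
are exactly the even residues. -/
theorem exists_affineCoordinates_of_gcd_eq_two {n : ℕ} (hn : 3 ≤ n) (heven : Even n)
    {u : (ZMod n)ˣ} (hu : u ∈ Upsilon n) (hgcd : Nat.gcd ((u : ZMod n).val + 1) n = 2) :
    ∃ g : Equiv.Perm (ZMod n), g 0 = 0 ∧ ∀ a, g (a + 1) = (u : ZMod n) * g a + 1 := by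
  have : NeZero n := ⟨by omega⟩
  have hval : (((u : ZMod n).val + 1 : ℕ) : ZMod n) = (u : ZMod n) + 1 := by
    rw [Nat.cast_succ, ZMod.natCast_zmod_val]
  let f : Equiv.Perm (ZMod n) := u.mulLeft.trans (Equiv.addRight 1)
  have hf : ∀ x, f x = (u : ZMod n) * x + 1 := fun x => rfl
  have hf2 : ∀ (k : ℕ) x, (f ^ (2 * k)) x = x + k * ((u : ZMod n) + 1) := by
    intro k x
    induction k with
    | zero => simp
    | succ k ih =>
      have : 2 * (k + 1) = 1 + 1 + 2 * k := by ring
      rw [this, pow_add, pow_add, pow_one, Equiv.Perm.mul_apply, Equiv.Perm.mul_apply, ih, hf, hf]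
      push_cast
      linear_combination (x + k * ((u : ZMod n) + 1)) * coe_sq_of_mem_Upsilon hu
  have hfn : f ^ n = 1 := by
    obtain ⟨m, rfl⟩ := heven.two_dvd
    ext1 x
    obtain ⟨q, hq⟩ := (val_odd_of_even heven u).add_one.two_dvd
    rw [hf2, ← hval, hq, ← Nat.cast_mul, show m * (2 * q) = 2 * m * q by ring, Nat.cast_mul,
      ZMod.natCast_self]
    simp
  have hmod : ∀ k : ℕ, f ^ (((k : ZMod n)).val) = f ^ k := by
    intro k
    rw [ZMod.val_natCast]
    conv_rhs => rw [← Nat.mod_add_div k n, pow_add, pow_mul, hfn, one_pow, mul_one]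
  have hsurj : Function.Surjective fun a : ZMod n => (f ^ a.val) 0 := by
    -- Bézout: a multiple of `u + 1` equals `2`
    obtain ⟨k, hk⟩ : ∃ k : ℕ, (k : ZMod n) * ((u : ZMod n) + 1) = 2 := by
      obtain ⟨k, hk⟩ := Nat.exists_mul_mod_eq_gcd (n := (u : ZMod n).val + 1) (k := n)
        (by rw [hgcd]; omega)
      refine ⟨k, ?_⟩
      rw [← hval, ← Nat.cast_mul, mul_comm, ← ZMod.natCast_mod, hk.2, hgcd, Nat.cast_ofNat]
    have hev : ∀ m : ℕ, (f ^ (2 * (k * m))) 0 = ((2 * m : ℕ) : ZMod n) := by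
      intro m
      rw [hf2]
      push_cast
      linear_combination (m : ZMod n) * hk
    intro b
    obtain ⟨b, rfl⟩ := ZMod.natCast_zmod_surjective b
    obtain ⟨m, rfl | rfl⟩ := Nat.even_or_odd' b
    · refine ⟨((2 * (k * m) : ℕ) : ZMod n), ?_⟩
      simp only [hmod, hev]
    · refine ⟨((2 * (k * m) + 1 : ℕ) : ZMod n), ?_⟩
      simp only [hmod]
      rw [pow_add, Equiv.Perm.mul_apply, hf2, pow_one, hf]
      push_cast
      linear_combination (m : ZMod n) * hk
  refine ⟨Equiv.ofBijective _ (Finite.surjective_iff_bijective.mp hsurj), by simp, fun a => ?_⟩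
  obtain ⟨k, rfl⟩ := ZMod.natCast_zmod_surjective a
  rw [← Nat.cast_succ]
  simp only [Equiv.ofBijective_apply, hmod]
  rw [pow_succ', Equiv.Perm.mul_apply, hf]

theorem ncard_affineCoordinates_of_even {n : ℕ} (hn : 3 ≤ n) (heven : Even n) :
    (affineCoordinates n).ncard = muCount n := by
  have : NeZero n := ⟨by omega⟩
  symm
  choose! F hF using fun (u : (ZMod n)ˣ)
    (hu : u ∈ Upsilon n ∧ Nat.gcd ((u : ZMod n).val + 1) n = 2) =>
    exists_affineCoordinates_of_gcd_eq_two hn heven hu.1 hu.2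
  refine Set.ncard_congr (fun u _ => F u) (fun u hu => ?_) (fun u v hu hv huv => ?_)
    (fun g hg => ?_)
  · exact ⟨(hF u hu).1, u, hu.1, (hF u hu).2⟩
  · -- the value at `2` is `u + 1`
    have h2 : ∀ w, (w ∈ Upsilon n ∧ Nat.gcd ((w : ZMod n).val + 1) n = 2) →
        F w (0 + 1 + 1) = w + 1 := by
      intro w hw
      rw [(hF w hw).2, (hF w hw).2, (hF w hw).1]
      ring
    have h3 := (h2 u hu).symm.trans ((DFunLike.congr_fun huv _).trans (h2 v hv))
    exact Units.ext (add_right_cancel h3)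
  · obtain ⟨h0, u, hu, h⟩ := hg
    have hu' : u ∈ Upsilon n ∧ Nat.gcd ((u : ZMod n).val + 1) n = 2 :=
      ⟨hu, gcd_eq_two_of_mem_affineCoordinates hn heven h0 hu h⟩
    refine ⟨u, hu', DFunLike.coe_injective (ZMod.ext_of_recurrence
      (F := fun a => (u : ZMod n) * a + 1) ?_ (hF u hu').2 h)⟩
    rw [(hF u hu').1, h0]

/-! ### The value of `muCount` -/

/-- For `n = 2m`, the condition `gcd (v + 1, n) = 2` turns `n ∣ (v + 1)(v - 1)` into
`m ∣ v - 1`. -/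
theorem eq_one_or_of_gcd_eq_two {m v : ℕ} (hv0 : 0 < v) (hv : v < 2 * m)
    (hsq : v ^ 2 ≡ 1 [MOD 2 * m]) (hgcd : Nat.gcd (v + 1) (2 * m) = 2) :
    v = 1 ∨ (8 ∣ 2 * m ∧ v = m + 1) := by
  obtain ⟨w, rfl⟩ : ∃ w, v = w + 1 := ⟨v - 1, by omega⟩
  have hdvd : 2 * m ∣ (w + 1 + 1) * w := by
    have h1 := (Nat.modEq_iff_dvd' (Nat.one_le_pow _ _ hv0)).mp hsq.symm
    have h2 : (w + 1) ^ 2 - 1 = (w + 1 + 1) * w := by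
      rw [Nat.sub_eq_iff_eq_add (Nat.one_le_pow _ _ hv0)]; ring
    rwa [h2] at h1
  obtain ⟨a, ha⟩ : 2 ∣ w + 1 + 1 := hgcd ▸ Nat.gcd_dvd_left _ _
  have hcop : Nat.Coprime a m := by
    rw [ha, Nat.gcd_mul_left] at hgcd
    unfold Nat.Coprime
    omega
  have hm : m ∣ w := by
    rw [ha, mul_assoc] at hdvd
    exact hcop.symm.dvd_of_dvd_mul_left (Nat.dvd_of_mul_dvd_mul_left two_pos hdvd)
  obtain ⟨q, rfl⟩ := hm
  have hq : q < 2 := by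
    by_contra hq
    have : m * 2 ≤ m * q := Nat.mul_le_mul_left m (by omega)
    omega
  interval_cases q
  · left; simp
  · right
    refine ⟨?_, by ring⟩
    -- here `m = 2 (a - 1)` with `a` coprime to `m`, so `a` is odd and `4 ∣ m`
    have ha2 : ¬ 2 ∣ a := by
      intro h2
      have h3 := Nat.dvd_gcd h2 (show 2 ∣ m by omega)
      rw [hcop] at h3
      omega
    omega

theorem muCount_eq {n : ℕ} (hn : 3 ≤ n) (heven : Even n) :
    muCount n = if 8 ∣ n then 2 else 1 := by
  have : NeZero n := ⟨by omega⟩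
  have : Fact (1 < n) := ⟨by omega⟩
  obtain ⟨m, rfl⟩ := heven.two_dvd
  have hval1 : (1 : ZMod (2 * m)).val = 1 := ZMod.val_one _
  have h1mem : (1 : (ZMod (2 * m))ˣ) ∈ {v : (ZMod (2 * m))ˣ | v ∈ Upsilon (2 * m) ∧
      Nat.gcd ((v : ZMod (2 * m)).val + 1) (2 * m) = 2} := by
    refine ⟨one_pow 2, ?_⟩
    rw [Units.val_one, hval1]
    exact Nat.gcd_mul_right_right 2 m ▸ by simp
  have hcases : ∀ v : (ZMod (2 * m))ˣ, v ∈ Upsilon (2 * m) →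
      Nat.gcd ((v : ZMod (2 * m)).val + 1) (2 * m) = 2 →
      v = 1 ∨ (8 ∣ 2 * m ∧ (v : ZMod (2 * m)) = (m + 1 : ℕ)) := by
    intro v hv hgcd
    have hpos : 0 < (v : ZMod (2 * m)).val := by
      rw [ZMod.val_pos]
      exact v.ne_zero
    have hsq : (v : ZMod (2 * m)).val ^ 2 ≡ 1 [MOD 2 * m] := by
      rw [← ZMod.natCast_eq_natCast_iff]
      push_cast
      rw [ZMod.natCast_zmod_val, sq]
      exact coe_sq_of_mem_Upsilon hv
    rcases eq_one_or_of_gcd_eq_two hpos (ZMod.val_lt _) hsq hgcd with h | ⟨h8, h⟩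
    · left
      apply Units.ext
      apply ZMod.val_injective
      rw [h, Units.val_one, hval1]
    · right
      exact ⟨h8, by rw [← h, ZMod.natCast_zmod_val]⟩
  unfold muCount
  split_ifs with h8
  · obtain ⟨p, rfl⟩ : 4 ∣ m := by omega
    have hp : 0 < p := by omega
    -- the second element is `1 + n / 2`
    have hsq : (((4 * p + 1 : ℕ) : ZMod (2 * (4 * p))) * (4 * p + 1 : ℕ)) = 1 := by
      have h0 : ((2 * (4 * p) : ℕ) : ZMod (2 * (4 * p))) = 0 := ZMod.natCast_self _
      push_cast at h0 ⊢
      linear_combination (2 * (p : ZMod (2 * (4 * p))) + 1) * h0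
    let v : (ZMod (2 * (4 * p)))ˣ := ⟨(4 * p + 1 : ℕ), (4 * p + 1 : ℕ), hsq, hsq⟩
    have hvval : (v : ZMod (2 * (4 * p))).val = 4 * p + 1 := by
      change (((4 * p + 1 : ℕ) : ZMod (2 * (4 * p)))).val = 4 * p + 1
      rw [ZMod.val_natCast, Nat.mod_eq_of_lt (by omega)]
    rw [Set.ncard_eq_two]
    refine ⟨1, v, ?_, Set.Subset.antisymm ?_ ?_⟩
    · intro h
      have h1 : (v : ZMod (2 * (4 * p))).val = 1 := by rw [← h, Units.val_one, hval1]
      omega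
    · rintro w ⟨hw, hgcd⟩
      rcases hcases w hw hgcd with h | ⟨-, h⟩
      · exact Or.inl h
      · exact Or.inr (Units.ext h)
    · rintro w (rfl | rfl)
      · exact h1mem
      · refine ⟨Units.ext (by rw [sq]; exact hsq), ?_⟩
        rw [hvval, show 4 * p + 1 + 1 = 2 * (2 * p + 1) by ring, Nat.gcd_mul_left]
        have : Nat.gcd (2 * p + 1) (4 * p) = 1 := by
          have h1 : Nat.Coprime (2 * p + 1) (2 * p) := by simp
          have h2 : Nat.Coprime (2 * p + 1) 2 := by simp
          rw [show 4 * p = 2 * (2 * p) by ring]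
          exact h2.mul_right h1
        rw [this]
  · rw [Set.ncard_eq_one]
    refine ⟨1, Set.Subset.antisymm ?_ ?_⟩
    · rintro w ⟨hw, hgcd⟩
      rcases hcases w hw hgcd with h | ⟨h, -⟩
      · exact h
      · exact absurd h h8
    · rintro w rfl
      exact h1mem

theorem mainTheorem2 (n : ℕ) (hn : 3 ≤ n) :
    (Odd n →
      (∀ N ∈ regularNormalizedOfType (DihedralGroup n) (DihedralGroup n),
        Subgroup.normalizer N ≤ wreathSubgroup (dihedralX₀ n) (dihedralY₀ n)) ∧
      (regularNormalizedOfType (DihedralGroup n) (DihedralGroup n)).ncard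
        = (Upsilon n).ncard ∧
      (regularNormalizedWithin (DihedralGroup n) (DihedralGroup n)
          (wreathSubgroup (dihedralX₀ n) (dihedralY₀ n))).ncard
        = (Upsilon n).ncard) ∧
    (Even n →
      (regularNormalizedWithin (DihedralGroup n) (DihedralGroup n)
          (wreathSubgroup (dihedralX₀ n) (dihedralY₀ n))).ncard
        = muCount n * (Upsilon n).ncard ∧
      muCount n = if 8 ∣ n then 2 else 1) := by
  refine ⟨fun hodd => ?_, fun heven => ?_⟩
  · have hle := fun N (hN : N ∈ regularNormalizedOfType (DihedralGroup n) (DihedralGroup n)) =>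
      normalizer_le_wreathSubgroup_of_odd hn hodd hN
    have heq : regularNormalizedWithin (DihedralGroup n) (DihedralGroup n)
        (wreathSubgroup (dihedralX₀ n) (dihedralY₀ n)) =
        regularNormalizedOfType (DihedralGroup n) (DihedralGroup n) :=
      Set.Subset.antisymm (fun N hN => hN.1) fun N hN => ⟨hN, hle N hN⟩
    have hcard := ncard_regularNormalizedWithin hn
    rw [affineCoordinates_of_odd hn hodd, Set.ncard_singleton, one_mul] at hcard
    exact ⟨hle, heq ▸ hcard, hcard⟩
  · exact ⟨by rw [ncard_regularNormalizedWithin hn, ncard_affineCoordinates_of_even hn heven],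
      muCount_eq hn heven⟩
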